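/- Let $K$ be a nonempty compact convex subset of a finite-dimensional real normed space (for instance $\mathbb{R}^n$). Call $K$ a simplex if its set of extreme points is finite and affinely independent. For a nonempty compact Hausdorff space $\Omega$ let $\mathcal{P}(\Omega)$ be the set of Borel probability measures on $\Omega$. A measurement on $K$ with sample space $\Omega$ is a map $m : K \to \mathcal{P}(\Omega)$ that is affine, i.e. $m(tx+(1-t)y) = t\,m(x)+(1-t)\,m(y)$ for $x,y\in K$, $0\le t\le 1$; write $m(x;\sigma)$ for the $m(x)$-measure of a Borel set $\sigma\subset\Omega$. Measurements $m_1 : K\to\mathcal{P}(\Omega_1)$ and $m_2 : K\to\mathcal{P}(\Omega_2)$ are compatible if there is a measurement $m : K\to\mathcal{P}(\Omega_1\times\Omega_2)$ (with the product topology on $\Omega_1\times\Omega_2$) such that $m_1(x;\sigma_1)=m(x;\sigma_1\times\Omega_2)$ and $m_2(x;\sigma_2)=m(x;\Omega_1\times\sigma_2)$ for all $x\in K$ and all Borel sets $\sigma_1\subset\Omega_1$, $\sigma_2\subset\Omega_2$; otherwise they are incompatible. (1) If $K$ is not a simplex, then there exist incompatible measurements on $K$; in fact there are two incompatible measurements on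 $K$ whose sample space is a (discrete) two-point space. (2) Consequently, together with the converse: any two measurements on $K$ with values in the regular Borel probability measures on (arbitrary) nonempty compact Hausdorff spaces are compatible if and only if $K$ is a simplex. -/

import Mathlib

open MeasureTheory

universe u v

/-- The set `𝒫(Ω)` of Borel probability measures on a topological space `Ω`. The σ-algebra is the
Borel σ-algebra of the given topology; on a product `Ω₁ × Ω₂` it is that of the product topology. -/
def BorelProb (Ω : Type*) [TopologicalSpace Ω] : Type _ :=
  {μ : @Measure Ω (borel Ω) // @IsProbabilityMeasure Ω (borel Ω) μ}

/-- A measurement on `K` with sample space `Ω`: an affine map from `K` to the Borel probability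
measures on `Ω`. -/
structure Measurement {E : Type*} [AddCommGroup E] [Module ℝ E] (K : Set E)
    (Ω : Type*) [TopologicalSpace Ω] where
  /-- The outcome distribution of each state. -/
  dist : K → BorelProb Ω
  /-- Affinity: convex combinations of states go to convex combinations of measures. -/
  affine : ∀ (x y z : K) (t : ℝ), 0 ≤ t → t ≤ 1 → (z : E) = t • (x : E) + (1 - t) • (y : E) →
    (dist z).1 = ENNReal.ofReal t • (dist x).1 + ENNReal.ofReal (1 - t) • (dist y).1

namespace Measurement

variable {E : Type*} [AddCommGroup E] [Module ℝ E] {K : Set E}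
  {Ω₁ Ω₂ : Type*} [TopologicalSpace Ω₁] [TopologicalSpace Ω₂]

/-- `m.prob x σ` is `m(x; σ)`, the probability that the outcome lies in `σ` in the state `x`. -/
noncomputable def prob (m : Measurement K Ω₁) (x : K) (σ : Set Ω₁) : ENNReal :=
  (m.dist x).1 σ

/-- All the outcome distributions are regular measures. -/
def IsRegular (m : Measurement K Ω₁) : Prop :=
  ∀ x : K, @Measure.Regular Ω₁ (borel Ω₁) _ (m.dist x).1

/-- `m₁` is the first marginal of `m`. -/
def IsFstMarginal (m₁ : Measurement K Ω₁) (m : Measurement K (Ω₁ × Ω₂)) : Prop :=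
  ∀ (x : K) (σ : Set Ω₁), MeasurableSet[borel Ω₁] σ → m₁.prob x σ = m.prob x (σ ×ˢ Set.univ)

/-- `m₂` is the second marginal of `m`. -/
def IsSndMarginal (m₂ : Measurement K Ω₂) (m : Measurement K (Ω₁ × Ω₂)) : Prop :=
  ∀ (x : K) (σ : Set Ω₂), MeasurableSet[borel Ω₂] σ → m₂.prob x σ = m.prob x (Set.univ ×ˢ σ)

/-- Two measurements are compatible if they are the marginals of one joint measurement. -/
def Compatible (m₁ : Measurement K Ω₁) (m₂ : Measurement K Ω₂) : Prop :=
  ∃ m : Measurement K (Ω₁ × Ω₂), m₁.IsFstMarginal m ∧ m₂.IsSndMarginal m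

end Measurement

/-- The (compact convex) set `K` is a simplex: it has finitely many extreme points, and they are
affinely independent. -/
def IsSimplex {E : Type*} [AddCommGroup E] [Module ℝ E] (K : Set E) : Prop :=
  (K.extremePoints ℝ).Finite ∧
    AffineIndependent ℝ (fun x : K.extremePoints ℝ => (x : E))

/-! A joint measurement of two-outcome measurements with effects f and g yields an affine h with
max(0, f + g - 1) ≤ h ≤ min(f, g). Suppose such an h always exists. The nonnegative affine functions
on K form a cone with a compact base, cut out by the value 1 at a relative interior point. Let e ≠
e' be extreme points of the base, rescaled to maximum 1. The h for this pair lies below both, hence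
is a multiple of both, so h = 0 and e + e' ≤ 1: each vanishes where the other is maximal
(`HasJointEffects.apply_eq_zero`). The maximum points are thus affinely independent, so finite in
number; by Krein–Milman the e's are a dual system for them, and a separation argument shows that K
is their convex hull (`HasJointEffects.isSimplex`).

Conversely, barycentric coordinates on a simplex are affine, so it suffices to couple the two
outcome laws at each vertex and extend affinely (`IsSimplex.compatible`). The Borel σ-algebra of a
product can exceed the product σ-algebra, so the coupling is built by Riesz–Markov
(`exists_coupling_borel`). -/

open scoped CompactlySupported

/-! ### Couplings of regular measures on compact spaces -/

theorem Continuous.integrable_of_compactSpace {Z : Type*} [TopologicalSpace Z] [CompactSpace Z]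
    [MeasurableSpace Z] [BorelSpace Z] {τ : Measure Z} [IsFiniteMeasure τ] {f : Z → ℝ}
    (hf : Continuous f) : Integrable f τ :=
  hf.integrable_of_hasCompactSupport (HasCompactSupport.of_compactSpace f)

theorem ContinuousMap.continuous_integral_right {X Y : Type*} [TopologicalSpace X]
    [TopologicalSpace Y] [CompactSpace Y] [MeasurableSpace Y] [BorelSpace Y] (ν : Measure Y)
    [IsProbabilityMeasure ν] (F : C(X × Y, ℝ)) : Continuous fun x => ∫ y, F (x, y) ∂ν := by
  have hI (f : C(Y, ℝ)) : Integrable f ν := f.continuous.integrable_of_compactSpace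
  have hL : LipschitzWith 1 fun f : C(Y, ℝ) => ∫ y, f y ∂ν := by
    refine LipschitzWith.of_dist_le_mul fun f g => ?_
    rw [NNReal.coe_one, one_mul, dist_eq_norm, ← integral_sub (hI f) (hI g)]
    refine (norm_integral_le_of_norm_le_const (C := dist f g)
      (Filter.Eventually.of_forall fun y => ?_)).trans (by simp)
    rw [← dist_eq_norm]
    exact ContinuousMap.dist_apply_le_dist y
  exact hL.continuous.comp F.curry.continuous

theorem MeasureTheory.Measure.map_eq_of_forall_integral_comp_eq {X Y : Type*} [TopologicalSpace X]
    [CompactSpace X] [T2Space X] [MeasurableSpace X] [BorelSpace X]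
    [TopologicalSpace Y] [CompactSpace Y] [T2Space Y] [MeasurableSpace Y] [BorelSpace Y]
    {ρ : Measure X} {μ : Measure Y} [IsFiniteMeasure ρ] [ρ.Regular] [μ.Regular] {p : X → Y}
    (hp : Continuous p) (h : ∀ f : C(Y, ℝ), ∫ x, f (p x) ∂ρ = ∫ y, f y ∂μ) : ρ.map p = μ := by
  -- Continuous images of compact sets are compact, so the image measure stays regular and Riesz
  -- uniqueness applies.
  have : (ρ.map p).InnerRegularCompactLTTop :=
    InnerRegularCompactLTTop.map_of_continuous hp
  refine Measure.ext_of_integral_eq_on_compactlySupported fun f => ?_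
  exact (integral_map hp.aemeasurable f.continuous.aestronglyMeasurable).trans (h f)

/-- The Riesz measure of the iterated integral. Keeping `X` apart from `X₁ × X₂` leaves its
σ-algebra free to be the Borel one instead of the product instance; the use below has `s` the
identity. -/
theorem exists_coupling_borel {X X₁ X₂ : Type*}
    [TopologicalSpace X] [CompactSpace X] [T2Space X] [MeasurableSpace X] [BorelSpace X]
    [TopologicalSpace X₁] [CompactSpace X₁] [T2Space X₁] [MeasurableSpace X₁] [BorelSpace X₁]
    [TopologicalSpace X₂] [CompactSpace X₂] [T2Space X₂] [MeasurableSpace X₂] [BorelSpace X₂]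
    (μ : Measure X₁) (ν : Measure X₂) [IsProbabilityMeasure μ] [IsProbabilityMeasure ν]
    [μ.Regular] [ν.Regular] (s : C(X₁ × X₂, X)) {p : X → X₁} {q : X → X₂} (hp : Continuous p)
    (hq : Continuous q) (hps : ∀ a b, p (s (a, b)) = a) (hqs : ∀ a b, q (s (a, b)) = b) :
    ∃ ρ : Measure X, IsProbabilityMeasure ρ ∧ ρ.map p = μ ∧ ρ.map q = ν := by
  have hc (F : C_c(X, ℝ)) : Continuous fun a => ∫ b, F (s (a, b)) ∂ν :=
    ContinuousMap.continuous_integral_right ν (F.toContinuousMap.comp s)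
  have hs (F : C_c(X, ℝ)) (a : X₁) : Integrable (fun b => F (s (a, b))) ν :=
    (F.continuous.comp (s.continuous.comp (by fun_prop))).integrable_of_compactSpace
  let Λ : C_c(X, ℝ) →ₚ[ℝ] ℝ := PositiveLinearMap.mk₀
    { toFun := fun F => ∫ a, ∫ b, F (s (a, b)) ∂ν ∂μ
      map_add' := fun F G => by
        refine Eq.trans ?_ (integral_add (hc F).integrable_of_compactSpace
          (hc G).integrable_of_compactSpace)
        refine integral_congr_ae (Filter.Eventually.of_forall fun a => ?_)
        exact integral_add (hs F a) (hs G a)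
      map_smul' := fun c F => by
        simp [integral_const_mul] }
    (fun F hF => integral_nonneg fun a => integral_nonneg fun b => hF _)
  have hΛ (f : C(X, ℝ)) : ∫ x, f x ∂(RealRMK.rieszMeasure Λ) = ∫ a, ∫ b, f (s (a, b)) ∂ν ∂μ :=
    RealRMK.integral_rieszMeasure Λ ⟨f, HasCompactSupport.of_compactSpace f⟩
  have h1 : (RealRMK.rieszMeasure Λ).map p = μ :=
    Measure.map_eq_of_forall_integral_comp_eq hp fun f => by
      refine (hΛ (f.comp ⟨p, hp⟩)).trans ?_
      simp [hps]
  have h2 : (RealRMK.rieszMeasure Λ).map q = ν :=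
    Measure.map_eq_of_forall_integral_comp_eq hq fun f => by
      refine (hΛ (f.comp ⟨q, hq⟩)).trans ?_
      simp [hqs]
  refine ⟨_, ⟨?_⟩, h1, h2⟩
  have := congrArg (fun τ => τ Set.univ) h1
  simpa [Measure.map_apply hp.measurable] using this

/-! ### Affine functions on a convex set -/

/-- A real function on a set which respects the convex combinations that stay in the set. -/
def IsAffineOn {E : Type*} [AddCommGroup E] [Module ℝ E] (K : Set E) (f : K → ℝ) : Prop :=
  ∀ (x y z : K) (t : ℝ), 0 ≤ t → t ≤ 1 → (z : E) = t • (x : E) + (1 - t) • (y : E) →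
    f z = t * f x + (1 - t) * f y

namespace IsAffineOn

section Module

variable {E : Type*} [AddCommGroup E] [Module ℝ E] {K : Set E} {f g : K → ℝ}

theorem add (hf : IsAffineOn K f) (hg : IsAffineOn K g) : IsAffineOn K (f + g) := by
  intro x y z t h0 h1 h
  simp only [Pi.add_apply, hf x y z t h0 h1 h, hg x y z t h0 h1 h]
  ring

theorem smul (c : ℝ) (hf : IsAffineOn K f) : IsAffineOn K (c • f) := by
  intro x y z t h0 h1 h
  simp only [Pi.smul_apply, smul_eq_mul, hf x y z t h0 h1 h]
  ring

theorem sub (hf : IsAffineOn K f) (hg : IsAffineOn K g) : IsAffineOn K (f - g) := by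
  intro x y z t h0 h1 h
  simp only [Pi.sub_apply, hf x y z t h0 h1 h, hg x y z t h0 h1 h]
  ring

theorem const (c : ℝ) : IsAffineOn K fun _ => c := by
  intro x y z t h0 h1 h
  ring

theorem of_linearMap (l : E →ₗ[ℝ] ℝ) : IsAffineOn K fun x => l x := by
  intro x y z t h0 h1 h
  simp [h]

theorem map_sum (hK : Convex ℝ K) (hf : IsAffineOn K f) {ι : Type*} (s : Finset ι) (w : ι → ℝ)
    (p : ι → K) (z : K) (hw : ∀ i ∈ s, 0 ≤ w i) (hs : ∑ i ∈ s, w i = 1)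
    (hz : (z : E) = ∑ i ∈ s, w i • (p i : E)) : f z = ∑ i ∈ s, w i * f (p i) := by
  classical
  let F : E → ℝ := fun x => if h : x ∈ K then f ⟨x, h⟩ else 0
  have hF (x : K) : F x = f x := dif_pos x.2
  have key : ∀ ⦃x⦄, x ∈ K → ∀ ⦃y⦄, y ∈ K → ∀ ⦃a b : ℝ⦄, 0 ≤ a → 0 ≤ b → a + b = 1 →
      F (a • x + b • y) = a • F x + b • F y := by
    intro x hx y hy a b ha hb hab
    obtain rfl : b = 1 - a := by linarith
    have := hf ⟨x, hx⟩ ⟨y, hy⟩ ⟨_, hK hx hy ha hb hab⟩ a ha (by linarith) rfl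
    rw [← hF, ← hF, ← hF] at this
    exact this
  have hconv : ConvexOn ℝ K F := ⟨hK, fun x hx y hy a b ha hb hab => (key hx hy ha hb hab).le⟩
  have hconc : ConcaveOn ℝ K F := ⟨hK, fun x hx y hy a b ha hb hab => (key hx hy ha hb hab).ge⟩
  have h1 := hconv.map_sum_le hw hs (p := fun i => (p i : E)) fun i _ => (p i).2
  have h2 := hconc.le_map_sum hw hs (p := fun i => (p i : E)) fun i _ => (p i).2
  simp only [← hz, hF, smul_eq_mul] at h1 h2
  exact le_antisymm h1 h2

/-- Separating positive from negative coefficients and normalising turns the relation into two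
convex combinations of the same point. -/
theorem sum_eq_zero (hK : Convex ℝ K) (hf : IsAffineOn K f) (s : Finset K) (c : K → ℝ)
    (h0 : ∑ x ∈ s, c x = 0) (h1 : ∑ x ∈ s, c x • (x : E) = 0) : ∑ x ∈ s, c x * f x = 0 := by
  have hsplit (r : ℝ) : r⁺ - r⁻ = r := posPart_sub_negPart r
  set S := ∑ x ∈ s, (c x)⁺ with hS
  have hS' : ∑ x ∈ s, (c x)⁻ = S := by
    have : ∑ x ∈ s, ((c x)⁺ - (c x)⁻) = 0 := by simpa only [hsplit] using h0
    rw [Finset.sum_sub_distrib] at this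
    linarith
  have hE : ∑ x ∈ s, (c x)⁺ • (x : E) = ∑ x ∈ s, (c x)⁻ • (x : E) := by
    rw [← sub_eq_zero, ← Finset.sum_sub_distrib, ← h1]
    simp only [← sub_smul, hsplit]
  suffices h : ∑ x ∈ s, (c x)⁺ * f x = ∑ x ∈ s, (c x)⁻ * f x by
    rw [← sub_eq_zero, ← Finset.sum_sub_distrib] at h
    simpa only [← sub_mul, hsplit] using h
  have hp : ∀ x ∈ s, 0 ≤ (c x)⁺ := fun x _ => posPart_nonneg _
  have hn : ∀ x ∈ s, 0 ≤ (c x)⁻ := fun x _ => negPart_nonneg _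
  rcases (Finset.sum_nonneg hp).eq_or_lt with hz | hpos
  · have e1 := (Finset.sum_eq_zero_iff_of_nonneg hp).1 hz.symm
    have e2 := (Finset.sum_eq_zero_iff_of_nonneg hn).1 (hS'.trans (hS.trans hz.symm))
    exact Finset.sum_congr rfl fun x hx => by rw [e1 x hx, e2 x hx]
  · have hpos : 0 < S := hpos
    have hp1 : ∀ x ∈ s, 0 ≤ (c x)⁺ / S := fun x hx => div_nonneg (hp x hx) hpos.le
    have hn1 : ∀ x ∈ s, 0 ≤ (c x)⁻ / S := fun x hx => div_nonneg (hn x hx) hpos.le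
    have sp : ∑ x ∈ s, (c x)⁺ / S = 1 := by rw [← Finset.sum_div, ← hS, div_self hpos.ne']
    have sn : ∑ x ∈ s, (c x)⁻ / S = 1 := by rw [← Finset.sum_div, hS', div_self hpos.ne']
    have hz : ∑ x ∈ s, ((c x)⁺ / S) • (x : E) ∈ K := hK.sum_mem hp1 sp fun x _ => x.2
    have e1 := hf.map_sum hK s _ id ⟨_, hz⟩ hp1 sp rfl
    have e2 := hf.map_sum hK s _ id ⟨_, hz⟩ hn1 sn (by
      simp only [div_eq_inv_mul, mul_smul, ← Finset.smul_sum, hE, id])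
    have e3 := e1.symm.trans e2
    simp only [div_eq_inv_mul, mul_assoc, ← Finset.mul_sum, id] at e3
    exact mul_left_cancel₀ (inv_ne_zero hpos.ne') e3

/-- By `sum_eq_zero` the extension of f to formal combinations vanishes on the kernel of x ↦ (x, 1),
so it factors through the range and extends to all of E × ℝ. -/
theorem exists_linearMap (hK : Convex ℝ K) (hf : IsAffineOn K f) :
    ∃ (l : E →ₗ[ℝ] ℝ) (c : ℝ), ∀ x : K, f x = l x + c := by
  let Φ : (K →₀ ℝ) →ₗ[ℝ] E × ℝ := Finsupp.linearCombination ℝ fun x : K => ((x : E), (1 : ℝ))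
  let Ψ : (K →₀ ℝ) →ₗ[ℝ] ℝ := Finsupp.linearCombination ℝ f
  have hker (c : K →₀ ℝ) (hc : Φ c = 0) : Ψ c = 0 := by
    simp only [Φ, Finsupp.linearCombination_apply, Finsupp.sum, Prod.ext_iff, Prod.fst_sum,
      Prod.snd_sum, Prod.smul_mk, Prod.fst_zero, Prod.snd_zero, smul_eq_mul, mul_one] at hc
    simp only [Ψ, Finsupp.linearCombination_apply, Finsupp.sum, smul_eq_mul]
    exact hf.sum_eq_zero hK _ _ hc.2 hc.1
  obtain ⟨σ, hσ⟩ := Φ.rangeRestrict.exists_rightInverse_of_surjective Φ.range_rangeRestrict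
  obtain ⟨G, hG⟩ := LinearMap.exists_extend (Ψ ∘ₗ σ)
  have hGΦ (c : K →₀ ℝ) : G (Φ c) = Ψ c := by
    have h1 : G (Φ c) = Ψ (σ (Φ.rangeRestrict c)) := LinearMap.congr_fun hG (Φ.rangeRestrict c)
    have h2 : Φ.rangeRestrict (σ (Φ.rangeRestrict c)) = Φ.rangeRestrict c :=
      LinearMap.congr_fun hσ _
    rw [h1, ← sub_eq_zero, ← map_sub]
    apply hker
    rw [map_sub, sub_eq_zero]
    exact congrArg Subtype.val h2
  refine ⟨G ∘ₗ LinearMap.inl ℝ E ℝ, G (0, 1), fun x => ?_⟩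
  have := hGΦ (Finsupp.single x 1)
  simp only [Φ, Ψ, Finsupp.linearCombination_single, one_smul] at this
  rw [← this, LinearMap.comp_apply, ← map_add]
  simp

end Module

theorem continuous {E : Type*} [NormedAddCommGroup E] [NormedSpace ℝ E] [FiniteDimensional ℝ E]
    {K : Set E} {f : K → ℝ} (hK : Convex ℝ K) (hf : IsAffineOn K f) : Continuous f := by
  obtain ⟨l, c, h⟩ := hf.exists_linearMap hK
  rw [funext h]
  exact (l.continuous_of_finiteDimensional.comp continuous_subtype_val).add_const c

end IsAffineOn

/-! ### The cone of nonnegative affine functions and its base -/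

theorem Convex.exists_mem_forall_exists_combination {E : Type*} [NormedAddCommGroup E]
    [NormedSpace ℝ E] [FiniteDimensional ℝ E] {K : Set E} (hK : Convex ℝ K) (hne : K.Nonempty) :
    ∃ x₀ : K, ∀ x : K, ∃ (t : ℝ) (y : K), 0 < t ∧ t ≤ 1 ∧
      (x₀ : E) = t • (x : E) + (1 - t) • (y : E) := by
  obtain ⟨_, z, hz, rfl⟩ := hne.intrinsicInterior hK
  refine ⟨⟨z, (interior_subset hz : z ∈ Subtype.val ⁻¹' K)⟩, fun x => ?_⟩
  have : Nonempty (affineSpan ℝ K) := ⟨z⟩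
  let x' : affineSpan ℝ K := ⟨x, subset_affineSpan ℝ K x.2⟩
  have hc : Continuous fun s : ℝ => AffineMap.lineMap z x' s := AffineMap.lineMap_continuous
  have hev : ∀ᶠ s in nhds (0 : ℝ), AffineMap.lineMap z x' s ∈ (Subtype.val ⁻¹' K : Set _) := by
    refine hc.continuousAt.eventually ?_
    beta_reduce
    rw [AffineMap.lineMap_apply_zero]
    exact mem_interior_iff_mem_nhds.1 hz
  obtain ⟨s, hs, hs0⟩ := ((hev.filter_mono nhdsWithin_le_nhds).and
    (self_mem_nhdsWithin : Set.Iio (0 : ℝ) ∈ nhdsWithin 0 (Set.Iio 0))).exists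
  have hs0 : s < 0 := hs0
  have h1 : 0 < 1 - s := by linarith
  -- Solve y = (1 - s) z + s x for z, where s < 0 and y is the point of the line just beyond z.
  refine ⟨-s / (1 - s), ⟨_, hs⟩, div_pos (by linarith) h1, ?_, ?_⟩
  · rw [div_le_one h1]
    linarith
  · have e : ((AffineMap.lineMap z x' s : affineSpan ℝ K) : E) = (1 - s) • (z : E) + s • (x : E) := by
      change s • ((x : E) - (z : E)) + (z : E) = _
      module
    have e2 : 1 - -s / (1 - s) = (1 - s)⁻¹ := by field_simp; ring
    rw [e2]
    simp only [e, smul_add, smul_smul, inv_mul_cancel₀ h1.ne', one_smul, div_eq_inv_mul]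
    rw [add_left_comm, ← add_smul]
    simp

/-- The nonnegative affine functions on `K` with value `1` at `x₀`: a base of the cone of
nonnegative affine functions when `x₀` is a relative interior point of `K`. -/
def affineBase {E : Type*} [AddCommGroup E] [Module ℝ E] (K : Set E) (x₀ : K) : Set (K → ℝ) :=
  {f | IsAffineOn K f ∧ (∀ x, 0 ≤ f x) ∧ f x₀ = 1}

section Module

variable {E : Type*} [AddCommGroup E] [Module ℝ E] {K : Set E} {x₀ : K}

theorem convex_affineBase : Convex ℝ (affineBase K x₀) := by
  intro f hf g hg a b ha hb hab
  refine ⟨(hf.1.smul a).add (hg.1.smul b), fun x => ?_, ?_⟩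
  · exact add_nonneg (mul_nonneg ha (hf.2.1 x)) (mul_nonneg hb (hg.2.1 x))
  · simpa [hf.2.2, hg.2.2] using hab

theorem isClosed_affineBase : IsClosed (affineBase K x₀) := by
  simp only [affineBase, IsAffineOn, Set.ofPred_and, Set.ofPred_forall]
  refine .inter ?_ (.inter ?_ (isClosed_eq (by fun_prop) (by fun_prop)))
  · exact isClosed_iInter fun x => isClosed_iInter fun y => isClosed_iInter fun z =>
      isClosed_iInter fun t => isClosed_iInter fun _ => isClosed_iInter fun _ =>
      isClosed_iInter fun _ => isClosed_eq (by fun_prop) (by fun_prop)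
  · exact isClosed_iInter fun x => isClosed_le (by fun_prop) (by fun_prop)

/-- Every point of `K` is an endpoint of a segment in `K` with `x₀` in its interior. -/
def IsInternalPoint (K : Set E) (x₀ : K) : Prop :=
  ∀ x : K, ∃ (t : ℝ) (y : K), 0 < t ∧ t ≤ 1 ∧ (x₀ : E) = t • (x : E) + (1 - t) • (y : E)

theorem IsInternalPoint.exists_forall_le (hx₀ : IsInternalPoint K x₀) (x : K) :
    ∃ M : ℝ, ∀ f, IsAffineOn K f → (∀ x, 0 ≤ f x) → f x ≤ M * f x₀ := by
  obtain ⟨t, y, ht0, ht1, h⟩ := hx₀ x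
  refine ⟨t⁻¹, fun f hf h0 => ?_⟩
  rw [hf x y x₀ t ht0.le ht1 h, inv_mul_eq_div, le_div_iff₀ ht0]
  nlinarith [mul_nonneg (sub_nonneg.2 ht1) (h0 y)]

theorem IsInternalPoint.eq_zero (hx₀ : IsInternalPoint K x₀) {f : K → ℝ} (hf : IsAffineOn K f)
    (h0 : ∀ x, 0 ≤ f x) (h : f x₀ = 0) : f = 0 := by
  funext x
  obtain ⟨M, hM⟩ := hx₀.exists_forall_le x
  exact le_antisymm (by simpa [h] using hM f hf h0) (h0 x)

/-- Tychonoff in the topology of pointwise convergence, with the bounds of `exists_forall_le`. -/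
theorem IsInternalPoint.isCompact_affineBase (hx₀ : IsInternalPoint K x₀) :
    IsCompact (affineBase K x₀) := by
  choose M hM using hx₀.exists_forall_le
  refine (isCompact_univ_pi fun x => isCompact_Icc (a := 0) (b := M x)).of_isClosed_subset
    isClosed_affineBase fun f hf x _ => ⟨hf.2.1 x, ?_⟩
  simpa [hf.2.2] using hM x f hf.1 hf.2.1

/-- Extreme points of the base span extreme rays: h and c e - h, once normalised, are base points
with e between them. -/
theorem IsInternalPoint.eq_smul_of_le (hx₀ : IsInternalPoint K x₀) {e h : K → ℝ}
    (he : e ∈ (affineBase K x₀).extremePoints ℝ) (hh : IsAffineOn K h) (h0 : ∀ x, 0 ≤ h x)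
    {c : ℝ} (hc : 0 < c) (hle : ∀ x, h x ≤ c * e x) : h = h x₀ • e := by
  have hE := he.1
  have hr : IsAffineOn K (c • e - h) := (hE.1.smul c).sub hh
  have hr0 (x : K) : 0 ≤ (c • e - h) x := sub_nonneg.2 (hle x)
  have hrx : (c • e - h) x₀ = c - h x₀ := by simp [hE.2.2]
  rcases (h0 x₀).eq_or_lt with hz | hpos
  · rw [← hz, zero_smul]
    exact hx₀.eq_zero hh h0 hz.symm
  rcases (hr0 x₀).eq_or_lt with hz | hpos'
  · have := hx₀.eq_zero hr hr0 hz.symm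
    rw [hrx] at hz
    rw [← sub_eq_zero.1 hz.symm, sub_eq_zero.1 this]
  · rw [hrx] at hpos'
    have m1 : (h x₀)⁻¹ • h ∈ affineBase K x₀ :=
      ⟨hh.smul _, fun x => mul_nonneg (inv_nonneg.2 hpos.le) (h0 x), inv_mul_cancel₀ hpos.ne'⟩
    have m2 : (c - h x₀)⁻¹ • (c • e - h) ∈ affineBase K x₀ :=
      ⟨hr.smul _, fun x => mul_nonneg (inv_nonneg.2 hpos'.le) (hr0 x), by
        rw [Pi.smul_apply, hrx]; exact inv_mul_cancel₀ hpos'.ne'⟩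
    have hseg : e ∈ openSegment ℝ ((h x₀)⁻¹ • h) ((c - h x₀)⁻¹ • (c • e - h)) := by
      refine ⟨h x₀ / c, (c - h x₀) / c, div_pos hpos hc, div_pos hpos' hc, ?_, ?_⟩
      · field_simp
        ring
      · funext x
        simp only [Pi.add_apply, Pi.smul_apply, Pi.sub_apply, smul_eq_mul]
        field_simp
        ring
    rw [← he.2 m1 m2 hseg, smul_smul, mul_inv_cancel₀ hpos.ne', one_smul]

/-! ### Joint effects force a simplex -/

/-- Any two two-valued measurements on `K`, given by the affine functions `f` and `g`, have a joint
measurement; `h` is the probability that both have the first outcome. -/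
def HasJointEffects (K : Set E) : Prop :=
  ∀ f g : K → ℝ, IsAffineOn K f → IsAffineOn K g → (∀ x, 0 ≤ f x ∧ f x ≤ 1) →
    (∀ x, 0 ≤ g x ∧ g x ≤ 1) →
    ∃ h, IsAffineOn K h ∧ ∀ x, 0 ≤ h x ∧ h x ≤ f x ∧ h x ≤ g x ∧ f x + g x - h x ≤ 1

theorem HasJointEffects.apply_eq_zero (hK : HasJointEffects K) (hx₀ : IsInternalPoint K x₀)
    {e e' : K → ℝ} (he : e ∈ (affineBase K x₀).extremePoints ℝ)
    (he' : e' ∈ (affineBase K x₀).extremePoints ℝ) (hne : e ≠ e') {p p' : K}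
    (hp : ∀ x, e x ≤ e p) (hp' : ∀ x, e' x ≤ e' p') : e' p = 0 := by
  have pos : 0 < e p := zero_lt_one.trans_le (he.1.2.2 ▸ hp x₀)
  have pos' : 0 < e' p' := zero_lt_one.trans_le (he'.1.2.2 ▸ hp' x₀)
  obtain ⟨h, hh, hb⟩ := hK ((e p)⁻¹ • e) ((e' p')⁻¹ • e') (he.1.1.smul _) (he'.1.1.smul _)
    (fun x => ⟨mul_nonneg (inv_nonneg.2 pos.le) (he.1.2.1 x),
      (inv_mul_le_one₀ pos).2 (hp x)⟩)
    (fun x => ⟨mul_nonneg (inv_nonneg.2 pos'.le) (he'.1.2.1 x),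
      (inv_mul_le_one₀ pos').2 (hp' x)⟩)
  have h1 := hx₀.eq_smul_of_le he hh (fun x => (hb x).1) (inv_pos.2 pos) fun x => (hb x).2.1
  have h2 := hx₀.eq_smul_of_le he' hh (fun x => (hb x).1) (inv_pos.2 pos') fun x => (hb x).2.2.1
  have hz : h x₀ = 0 := by
    by_contra hz
    exact hne (smul_right_injective _ hz (h1.symm.trans h2))
  rw [hz, zero_smul] at h1
  -- With h = 0, the bound f + g ≤ 1 at p, where f = 1, leaves g ≤ 0.
  have h3 := (hb p).2.2.2
  simp only [h1, Pi.zero_apply, Pi.smul_apply, smul_eq_mul, inv_mul_cancel₀ pos.ne', sub_zero] at h3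
  have h4 : (e' p')⁻¹ * e' p ≤ 0 := by linarith
  exact le_antisymm (nonpos_of_mul_nonpos_right h4 (inv_pos.2 pos')) (he'.1.2.1 p)

/-- A Radon point would lie in two disjoint convex sets: where some `e i` with i ∈ I is positive,
and where all of them vanish. -/
theorem affineIndependent_of_dual (hK : Convex ℝ K) {ι : Type*} (p : ι → K) (e : ι → K → ℝ)
    (he : ∀ i, IsAffineOn K (e i)) (h0 : ∀ i x, 0 ≤ e i x) (hpos : ∀ i, 0 < e i (p i))
    (hz : ∀ i j, i ≠ j → e i (p j) = 0) : AffineIndependent ℝ fun i => (p i : E) := by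
  by_contra h
  obtain ⟨I, y, hy, hy'⟩ := Convex.radon_partition h
  have c1 : Convex ℝ {x : E | ∃ h : x ∈ K, ∃ i ∈ I, 0 < e i ⟨x, h⟩} := by
    rintro x ⟨hx, i, hi, hxi⟩ x' ⟨hx', i', hi', hxi'⟩ a b ha hb hab
    obtain rfl : b = 1 - a := by linarith
    have ha1 : a ≤ 1 := by linarith
    refine ⟨hK hx hx' ha hb hab, ?_⟩
    rcases ha.eq_or_lt with rfl | ha'
    · refine ⟨i', hi', ?_⟩
      simpa using hxi'
    · refine ⟨i, hi, ?_⟩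
      rw [he i ⟨x, hx⟩ ⟨x', hx'⟩ _ a ha ha1 rfl]
      exact add_pos_of_pos_of_nonneg (mul_pos ha' hxi) (mul_nonneg hb (h0 _ _))
  have c2 : Convex ℝ {x : E | ∃ h : x ∈ K, ∀ i ∈ I, e i ⟨x, h⟩ = 0} := by
    rintro x ⟨hx, hxi⟩ x' ⟨hx', hxi'⟩ a b ha hb hab
    obtain rfl : b = 1 - a := by linarith
    refine ⟨hK hx hx' ha hb hab, fun i hi => ?_⟩
    rw [he i ⟨x, hx⟩ ⟨x', hx'⟩ _ a ha (by linarith) rfl, hxi i hi, hxi' i hi]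
    simp
  obtain ⟨_, i, hi, hyi⟩ := convexHull_min (by
    rintro _ ⟨i, hi, rfl⟩
    exact ⟨(p i).2, i, hi, hpos i⟩) c1 hy
  obtain ⟨_, hyz⟩ := convexHull_min (by
    rintro _ ⟨j, hj, rfl⟩
    exact ⟨(p j).2, fun i hi => hz i j fun hij => hj (hij ▸ hi)⟩) c2 hy'
  exact hyi.ne' (hyz i hi)

end Module

/-- If l < u on the hull but l x > u, expanding 1 and N - l at x gives N - l x ≥ N - u, a
contradiction. -/
theorem subset_convexHull_of_dual {E : Type*} [NormedAddCommGroup E]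
    [NormedSpace ℝ E] {K : Set E} (hcompact : IsCompact K)
    {ι : Type*} [Fintype ι] (p : ι → K) (e : ι → K → ℝ) (h0 : ∀ i x, 0 ≤ e i x)
    (hrep : ∀ f : K → ℝ, IsAffineOn K f → (∀ x, 0 ≤ f x) → ∀ x, f x = ∑ i, f (p i) * e i x) :
    K ⊆ convexHull ℝ (Set.range fun i => (p i : E)) := by
  intro x hx
  by_contra hxp
  obtain ⟨l, u, hlu, hux⟩ := geometric_hahn_banach_closed_point (convex_convexHull ℝ _)
    ((Set.finite_range fun i => (p i : E)).isClosed_convexHull ℝ) hxp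
  obtain ⟨N, hN⟩ := (hcompact.image l.continuous).bddAbove
  have hsum := hrep _ (IsAffineOn.const 1) (fun _ => zero_le_one) ⟨x, hx⟩
  have hl := hrep (fun y => N - l y) ((IsAffineOn.const N).sub (IsAffineOn.of_linearMap l.toLinearMap))
    (fun y => sub_nonneg.2 (hN ⟨y, y.2, rfl⟩)) ⟨x, hx⟩
  simp only [one_mul] at hsum
  have hle : ∑ i, (N - u) * e i ⟨x, hx⟩ ≤ ∑ i, (N - l (p i)) * e i ⟨x, hx⟩ :=
    Finset.sum_le_sum fun i _ => mul_le_mul_of_nonneg_right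
      (by linarith [hlu _ (subset_convexHull ℝ _ ⟨i, rfl⟩)]) (h0 _ _)
  rw [← Finset.mul_sum, ← hsum, ← hl] at hle
  linarith

theorem HasJointEffects.isSimplex {E : Type*} [NormedAddCommGroup E] [NormedSpace ℝ E]
    [FiniteDimensional ℝ E] {K : Set E} (hK : HasJointEffects K) (hne : K.Nonempty)
    (hcompact : IsCompact K) (hconvex : Convex ℝ K) : IsSimplex K := by
  obtain ⟨x₀, hx₀⟩ := hconvex.exists_mem_forall_exists_combination hne
  replace hx₀ : IsInternalPoint K x₀ := hx₀
  set T := (affineBase K x₀).extremePoints ℝ with hT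
  have : CompactSpace K := isCompact_iff_compactSpace.1 hcompact
  have : Nonempty K := ⟨x₀⟩
  have hmax (e : T) : ∃ p : K, ∀ x, e.1 x ≤ e.1 p := by
    obtain ⟨p, -, hp⟩ := isCompact_univ.exists_isMaxOn Set.univ_nonempty
      (e.2.1.1.continuous hconvex).continuousOn
    exact ⟨p, fun x => hp (Set.mem_univ x)⟩
  choose p hp using hmax
  have hpos (e : T) : 0 < e.1 (p e) := zero_lt_one.trans_le (e.2.1.2.2 ▸ hp e x₀)
  have hzero (e e' : T) (h : e ≠ e') : e.1 (p e') = 0 :=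
    hK.apply_eq_zero hx₀ e'.2 e.2 (fun h' => h (Subtype.ext h'.symm)) (hp e') (hp e)
  have hind : AffineIndependent ℝ fun e : T => (p e : E) :=
    affineIndependent_of_dual hconvex p (fun e => e.1) (fun e => e.2.1.1) (fun e => e.2.1.2.1)
      hpos hzero
  have : Finite T := finite_of_fin_dim_affineIndependent ℝ hind
  have := Fintype.ofFinite T
  -- The expansion is linear in f, so it need only be checked on `T`; as `T` is finite, its hull is
  -- already closed.
  have hspan : affineBase K x₀ ⊆ {f | ∀ x, f x = ∑ e : T, f (p e) * ((e.1 (p e))⁻¹ * e.1 x)} := by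
    rw [← closure_convexHull_extremePoints hx₀.isCompact_affineBase convex_affineBase,
      ((Set.toFinite T).isClosed_convexHull ℝ).closure_eq]
    refine convexHull_min (fun e he x => ?_) fun f hf g hg a b _ _ _ x => ?_
    · rw [Finset.sum_eq_single (⟨e, he⟩ : T)]
      · rw [mul_inv_cancel_left₀ (hpos ⟨e, he⟩).ne']
      · intro e' _ hne'
        rw [show e (p e') = 0 from hzero ⟨e, he⟩ e' hne'.symm, zero_mul]
      · simp
    · simp only [Pi.add_apply, Pi.smul_apply, smul_eq_mul, add_mul, Finset.sum_add_distrib,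
        mul_assoc, ← Finset.mul_sum]
      rw [hf x, hg x]
  have hsub : K ⊆ convexHull ℝ (Set.range fun e : T => (p e : E)) := by
    refine subset_convexHull_of_dual hcompact p (fun e x => (e.1 (p e))⁻¹ * e.1 x)
      (fun e x => mul_nonneg (inv_nonneg.2 (hpos e).le) (e.2.1.2.1 x)) fun f hf h0 x => ?_
    rcases (h0 x₀).eq_or_lt with hz | hf0
    · simp [hx₀.eq_zero hf h0 hz.symm]
    · have := hspan (show (f x₀)⁻¹ • f ∈ affineBase K x₀ from ⟨hf.smul _, fun x =>
        mul_nonneg (inv_nonneg.2 hf0.le) (h0 x), inv_mul_cancel₀ hf0.ne'⟩) x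
      simp only [Pi.smul_apply, smul_eq_mul, mul_assoc (f x₀)⁻¹, ← Finset.mul_sum] at this
      exact mul_left_cancel₀ (inv_ne_zero hf0.ne') this
  have heq : K = convexHull ℝ (Set.range fun e : T => (p e : E)) :=
    hsub.antisymm (convexHull_min (by rintro _ ⟨e, rfl⟩; exact (p e).2) hconvex)
  have hext : K.extremePoints ℝ ⊆ Set.range fun e : T => (p e : E) := by
    conv_lhs => rw [heq]
    exact extremePoints_convexHull_subset
  exact ⟨(Set.finite_range _).subset hext, hind.range.mono hext⟩

/-! ### Two-outcome measurements -/

namespace Measurement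

section Module

variable {E : Type*} [AddCommGroup E] [Module ℝ E] {K : Set E} {Ω : Type*} [TopologicalSpace Ω]

theorem prob_univ (m : Measurement K Ω) (x : K) : m.prob x Set.univ = 1 :=
  (m.dist x).2.measure_univ

theorem prob_mono (m : Measurement K Ω) (x : K) {σ τ : Set Ω} (h : σ ⊆ τ) :
    m.prob x σ ≤ m.prob x τ :=
  measure_mono h

theorem prob_ne_top (m : Measurement K Ω) (x : K) (σ : Set Ω) : m.prob x σ ≠ ⊤ :=
  ne_top_of_le_ne_top ENNReal.one_ne_top (m.prob_univ x ▸ m.prob_mono x σ.subset_univ)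

theorem isAffineOn_prob (m : Measurement K Ω) (σ : Set Ω) :
    IsAffineOn K fun x => (m.prob x σ).toReal := by
  intro x y z t h0 h1 h
  have hz : m.prob z σ = ENNReal.ofReal t * m.prob x σ + ENNReal.ofReal (1 - t) * m.prob y σ := by
    rw [prob, m.affine x y z t h0 h1 h]
    rfl
  simp only [hz]
  rw [ENNReal.toReal_add (ENNReal.mul_ne_top ENNReal.ofReal_ne_top (m.prob_ne_top x σ))
    (ENNReal.mul_ne_top ENNReal.ofReal_ne_top (m.prob_ne_top y σ)), ENNReal.toReal_mul,
    ENNReal.toReal_mul, ENNReal.toReal_ofReal h0, ENNReal.toReal_ofReal (sub_nonneg.2 h1)]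

theorem prob_eq_sum (hK : Convex ℝ K) (m : Measurement K Ω) (σ : Set Ω) {ι : Type*} [Fintype ι]
    (w : ι → ℝ) (p : ι → K) (z : K) (hw : ∀ i, 0 ≤ w i) (hs : ∑ i, w i = 1)
    (hz : (z : E) = ∑ i, w i • (p i : E)) :
    m.prob z σ = ∑ i, ENNReal.ofReal (w i) * m.prob (p i) σ := by
  have h := (m.isAffineOn_prob σ).map_sum hK Finset.univ w p z (fun i _ => hw i) hs hz
  have htop (i : ι) : ENNReal.ofReal (w i) * m.prob (p i) σ ≠ ⊤ :=
    ENNReal.mul_ne_top ENNReal.ofReal_ne_top (m.prob_ne_top _ σ)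
  rw [← ENNReal.toReal_eq_toReal_iff' (m.prob_ne_top z σ) (ENNReal.sum_ne_top.2 fun i _ => htop i),
    ENNReal.toReal_sum fun i _ => htop i, h]
  exact Finset.sum_congr rfl fun i _ => by rw [ENNReal.toReal_mul, ENNReal.toReal_ofReal (hw i)]

theorem ofReal_smul_combination {M : Type*} [AddCommMonoid M] [Module ENNReal M]
    {t r s : ℝ} (ht0 : 0 ≤ t) (ht1 : t ≤ 1) (hr : 0 ≤ r) (hs : 0 ≤ s) (μ : M) :
    ENNReal.ofReal (t * r + (1 - t) * s) • μ = ENNReal.ofReal t • ENNReal.ofReal r • μ +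
      ENNReal.ofReal (1 - t) • ENNReal.ofReal s • μ := by
  have ht1 := sub_nonneg.2 ht1
  rw [ENNReal.ofReal_add (mul_nonneg ht0 hr) (mul_nonneg ht1 hs), ENNReal.ofReal_mul ht0,
    ENNReal.ofReal_mul ht1, add_smul, mul_smul, mul_smul]

/-- The measurement with outcomes `a` and `b`, in which `a` has probability `f x` in the state
`x`. -/
noncomputable def ofEffect (a b : Ω) (f : K → ℝ) (hf : IsAffineOn K f)
    (h : ∀ x, 0 ≤ f x ∧ f x ≤ 1) : Measurement K Ω where
  dist x := ⟨letI := borel Ω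
    ENNReal.ofReal (f x) • Measure.dirac a + ENNReal.ofReal (1 - f x) • Measure.dirac b,
    letI := borel Ω
    ⟨by
      simp [← ENNReal.ofReal_add (h x).1 (sub_nonneg.2 (h x).2)]⟩⟩
  affine x y z t h0 h1 hz := by
    let := borel Ω
    have e1 := hf x y z t h0 h1 hz
    have e2 : 1 - f z = t * (1 - f x) + (1 - t) * (1 - f y) := by rw [e1]; ring
    simp only [e2]
    simp only [e1]
    rw [ofReal_smul_combination h0 h1 (h x).1 (h y).1, ofReal_smul_combination h0 h1
      (sub_nonneg.2 (h x).2) (sub_nonneg.2 (h y).2), smul_add, smul_add, add_add_add_comm]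

theorem prob_ofEffect [T1Space Ω] {a b : Ω} (hab : a ≠ b) (f : K → ℝ) (hf : IsAffineOn K f)
    (h : ∀ x, 0 ≤ f x ∧ f x ≤ 1) (x : K) :
    ((ofEffect a b f hf h).prob x {a}).toReal = f x := by
  let := borel Ω
  have : BorelSpace Ω := ⟨rfl⟩
  have : (ofEffect a b f hf h).prob x {a} = ENNReal.ofReal (f x) := by
    simp [prob, ofEffect, hab.symm]
  rw [this, ENNReal.toReal_ofReal (h x).1]

theorem isRegular_ofEffect [Finite Ω] [DiscreteTopology Ω] (a b : Ω) (f : K → ℝ)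
    (hf : IsAffineOn K f) (h : ∀ x, 0 ≤ f x ∧ f x ≤ 1) : (ofEffect a b f hf h).IsRegular := by
  intro x
  let := borel Ω
  have : BorelSpace Ω := ⟨rfl⟩
  have := ((ofEffect a b f hf h).dist x).2
  infer_instance

end Module

variable {E : Type*} [AddCommGroup E] [Module ℝ E] {K : Set E}

theorem hasJointEffects {Ω : Type*} [TopologicalSpace Ω] [T1Space Ω] {a b : Ω} (hab : a ≠ b)
    (H : ∀ (f g : K → ℝ) (hf : IsAffineOn K f) (hg : IsAffineOn K g)
      (hf' : ∀ x, 0 ≤ f x ∧ f x ≤ 1) (hg' : ∀ x, 0 ≤ g x ∧ g x ≤ 1),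
      (ofEffect a b f hf hf').Compatible (ofEffect a b g hg hg')) : HasJointEffects K := by
  intro f g hf hg hf' hg'
  obtain ⟨m, h1, h2⟩ := H f g hf hg hf' hg'
  have ha : MeasurableSet[borel Ω] ({a} : Set Ω) :=
    letI := borel Ω
    have : BorelSpace Ω := ⟨rfl⟩
    isClosed_singleton.measurableSet
  refine ⟨_, m.isAffineOn_prob ({a} ×ˢ {a}), fun x => ?_⟩
  have e1 : f x = (m.prob x ({a} ×ˢ Set.univ)).toReal := by
    rw [← h1 x {a} ha, prob_ofEffect hab]
  have e2 : g x = (m.prob x (Set.univ ×ˢ {a})).toReal := by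
    rw [← h2 x {a} ha, prob_ofEffect hab]
  have hle {σ τ : Set (Ω × Ω)} (h : σ ⊆ τ) : (m.prob x σ).toReal ≤ (m.prob x τ).toReal :=
    ENNReal.toReal_mono (m.prob_ne_top x τ) (m.prob_mono x h)
  refine ⟨ENNReal.toReal_nonneg, ?_, ?_, ?_⟩
  · rw [e1]
    exact hle (Set.prod_mono subset_rfl (Set.subset_univ _))
  · rw [e2]
    exact hle (Set.prod_mono (Set.subset_univ _) subset_rfl)
  · let := borel (Ω × Ω)
    have : BorelSpace (Ω × Ω) := ⟨rfl⟩
    -- Inclusion–exclusion: f + g - h is the probability that at least one outcome is `a`.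
    have hu := measure_union_add_inter (μ := (m.dist x).1) (({a} : Set Ω) ×ˢ (Set.univ : Set Ω))
      (isClosed_univ.prod (isClosed_singleton (x := a))).measurableSet
    rw [Set.prod_inter_prod, Set.inter_univ, Set.univ_inter] at hu
    have hr := congrArg ENNReal.toReal hu
    change (m.prob x _ + m.prob x _).toReal = (m.prob x _ + m.prob x _).toReal at hr
    rw [ENNReal.toReal_add (m.prob_ne_top x _) (m.prob_ne_top x _),
      ENNReal.toReal_add (m.prob_ne_top x _) (m.prob_ne_top x _)] at hr
    have h3 := hle (Set.subset_univ (({a} : Set Ω) ×ˢ (Set.univ : Set Ω) ∪ Set.univ ×ˢ {a}))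
    rw [prob_univ, ENNReal.toReal_one] at h3
    rw [e1, e2]
    linarith

end Measurement

/-! ### Compatibility on a simplex -/

theorem IsSimplex.exists_barycentric {E : Type v} [NormedAddCommGroup E] [NormedSpace ℝ E]
    {K : Set E} (hK : IsSimplex K) (hcompact : IsCompact K) (hconvex : Convex ℝ K) :
    ∃ (ι : Type v) (_ : Fintype ι) (p : ι → K) (w : ι → K → ℝ), (∀ i, IsAffineOn K (w i)) ∧
      (∀ i x, 0 ≤ w i x) ∧ (∀ x, ∑ i, w i x = 1) ∧ ∀ x : K, (x : E) = ∑ i, w i x • (p i : E) := by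
  obtain ⟨hfin, hind⟩ := hK
  let := hfin.fintype
  have hmem (x : K) : ∃ w : K.extremePoints ℝ → ℝ, (∀ i, 0 ≤ w i) ∧ ∑ i, w i = 1 ∧
      (x : E) = ∑ i, w i • (i : E) := by
    have hx : (x : E) ∈ closure (convexHull ℝ (K.extremePoints ℝ)) :=
      (closure_convexHull_extremePoints hcompact hconvex).symm ▸ x.2
    rw [(hfin.isClosed_convexHull ℝ).closure_eq, hfin.convexHull_eq_image] at hx
    obtain ⟨w, ⟨hw0, hw1⟩, hwx⟩ := hx
    refine ⟨w, hw0, hw1, ?_⟩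
    rw [← hwx]
    simp
  choose w h0 h1 hx using hmem
  refine ⟨K.extremePoints ℝ, inferInstance, fun i => ⟨i, i.2.1⟩, fun i x => w x i, fun i x y z t ht0 ht1 hz => ?_,
    fun i x => h0 x i, h1, hx⟩
  -- Barycentric coordinates are unique, hence affine.
  refine sub_eq_zero.1 (affineIndependent_iff.1 hind Finset.univ
    (fun i => w z i - (t * w x i + (1 - t) * w y i)) ?_ ?_ i (Finset.mem_univ i))
  · simp only [Finset.sum_sub_distrib, Finset.sum_add_distrib, ← Finset.mul_sum, h1]
    ring
  · simp only [sub_smul, add_smul, mul_smul, Finset.sum_sub_distrib, Finset.sum_add_distrib,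
      ← Finset.smul_sum, ← hx]
    rw [hz]
    module

theorem IsSimplex.compatible {E : Type*} [NormedAddCommGroup E] [NormedSpace ℝ E]
    {K : Set E} (hK : IsSimplex K) (hcompact : IsCompact K) (hconvex : Convex ℝ K)
    {Ω₁ Ω₂ : Type*} [TopologicalSpace Ω₁] [CompactSpace Ω₁] [T2Space Ω₁]
    [TopologicalSpace Ω₂] [CompactSpace Ω₂] [T2Space Ω₂]
    {m₁ : Measurement K Ω₁} {m₂ : Measurement K Ω₂} (h₁ : m₁.IsRegular) (h₂ : m₂.IsRegular) :
    m₁.Compatible m₂ := by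
  obtain ⟨ι, _, p, w, hw, hw0, hw1, hx⟩ := hK.exists_barycentric hcompact hconvex
  have hρ (i : ι) : ∃ ρ : BorelProb (Ω₁ × Ω₂),
      (∀ σ, MeasurableSet[borel Ω₁] σ → ρ.1 (σ ×ˢ Set.univ) = m₁.prob (p i) σ) ∧
      ∀ σ, MeasurableSet[borel Ω₂] σ → ρ.1 (Set.univ ×ˢ σ) = m₂.prob (p i) σ := by
    let : MeasurableSpace Ω₁ := borel Ω₁
    have : BorelSpace Ω₁ := ⟨rfl⟩
    let : MeasurableSpace Ω₂ := borel Ω₂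
    have : BorelSpace Ω₂ := ⟨rfl⟩
    have := (m₁.dist (p i)).2
    have := (m₂.dist (p i)).2
    have := h₁ (p i)
    have := h₂ (p i)
    let : MeasurableSpace (Ω₁ × Ω₂) := borel (Ω₁ × Ω₂)
    have : BorelSpace (Ω₁ × Ω₂) := ⟨rfl⟩
    obtain ⟨ρ, hprob, hfst, hsnd⟩ := exists_coupling_borel (X := Ω₁ × Ω₂) (m₁.dist (p i)).1
      (m₂.dist (p i)).1 (ContinuousMap.id _) continuous_fst continuous_snd (fun _ _ => rfl)
      (fun _ _ => rfl)
    refine ⟨⟨ρ, hprob⟩, fun σ hσ => ?_, fun σ hσ => ?_⟩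
    · rw [Measurement.prob, ← hfst, Measure.map_apply continuous_fst.measurable hσ, Set.prod_univ]
    · rw [Measurement.prob, ← hsnd, Measure.map_apply continuous_snd.measurable hσ, Set.univ_prod]
  choose ρ hρ₁ hρ₂ using hρ
  let : MeasurableSpace (Ω₁ × Ω₂) := borel (Ω₁ × Ω₂)
  refine ⟨⟨fun x => ⟨∑ i, ENNReal.ofReal (w i x) • (ρ i).1, ⟨?_⟩⟩, ?_⟩, ?_, ?_⟩
  · have (i : ι) : (ρ i).1 Set.univ = 1 := (ρ i).2.measure_univ
    simp only [Measure.coe_finsetSum, Finset.sum_apply, Measure.smul_apply, this, smul_eq_mul,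
      mul_one]
    rw [← ENNReal.ofReal_sum_of_nonneg fun i _ => hw0 i x, hw1, ENNReal.ofReal_one]
  · intro x y z t h0 h1 hz
    simp only [Finset.smul_sum, ← Finset.sum_add_distrib]
    refine Finset.sum_congr rfl fun i _ => ?_
    rw [hw i x y z t h0 h1 hz, Measurement.ofReal_smul_combination h0 h1 (hw0 i x) (hw0 i y)]
  · intro x σ hσ
    rw [m₁.prob_eq_sum hconvex σ (fun i => w i x) p x (fun i => hw0 i x) (hw1 x) (hx x)]
    simp only [Measurement.prob, Measure.coe_finsetSum, Finset.sum_apply, Measure.smul_apply,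
      smul_eq_mul, hρ₁ _ σ hσ]
  · intro x σ hσ
    rw [m₂.prob_eq_sum hconvex σ (fun i => w i x) p x (fun i => hw0 i x) (hw1 x) (hx x)]
    simp only [Measurement.prob, Measure.coe_finsetSum, Finset.sum_apply, Measure.smul_apply,
      smul_eq_mul, hρ₂ _ σ hσ]

theorem mainTheorem1 {E : Type v} [NormedAddCommGroup E] [NormedSpace ℝ E]
    [FiniteDimensional ℝ E] (K : Set E) (hne : K.Nonempty) (hcompact : IsCompact K)
    (hconvex : Convex ℝ K) :
    (¬ IsSimplex K → ∃ m₁ m₂ : Measurement K Bool, ¬ m₁.Compatible m₂) ∧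
    ((∀ (Ω₁ Ω₂ : Type u) [TopologicalSpace Ω₁] [CompactSpace Ω₁] [T2Space Ω₁] [Nonempty Ω₁]
        [TopologicalSpace Ω₂] [CompactSpace Ω₂] [T2Space Ω₂] [Nonempty Ω₂]
        (m₁ : Measurement K Ω₁) (m₂ : Measurement K Ω₂),
        m₁.IsRegular → m₂.IsRegular → m₁.Compatible m₂) ↔ IsSimplex K) := by
  refine ⟨fun hK => ?_, fun H => ?_, fun hK => ?_⟩
  · by_contra! H
    exact hK ((Measurement.hasJointEffects (Bool.false_ne_true).symm
      fun f g hf hg hf' hg' => H _ _).isSimplex hne hcompact hconvex)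
  -- The two-point space is lifted to the universe over which `H` quantifies.
  · have hab : ULift.up.{u} true ≠ ULift.up.{u} false := by simp
    exact (Measurement.hasJointEffects hab fun f g hf hg hf' hg' => H _ _ _ _
      (Measurement.isRegular_ofEffect _ _ f hf hf')
      (Measurement.isRegular_ofEffect _ _ g hg hg')).isSimplex hne hcompact hconvex
  · intro Ω₁ Ω₂ _ _ _ _ _ _ _ _ m₁ m₂ h₁ h₂
    exact hK.compatible hcompact hconvex h₁ h₂
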